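/- Let $\mathbb K$ be a field and $\mathbb K[\mathbf x]=\mathbb K[x_1,\dots,x_n]$. A sequence (or series) $\sigma=(\sigma_\alpha)_{\alpha\in\mathbb N^n}\in\mathbb K^{\mathbb N^n}$ is identified with the linear form $\langle\sigma\mid\sum_\alpha p_\alpha\mathbf x^\alpha\rangle=\sum_\alpha p_\alpha\sigma_\alpha$ on $\mathbb K[\mathbf x]$. Put $\langle p,q\rangle_\sigma=\langle\sigma\mid pq\rangle$, let $H_\sigma:\mathbb K[\mathbf x]\to\mathbb K[\mathbf x]^*$, $p\mapsto(q\mapsto\langle\sigma\mid pq\rangle)$ be the Hankel operator, $I_\sigma=\ker H_\sigma$ (an ideal) and $\mathcal A_\sigma=\mathbb K[\mathbf x]/I_\sigma$. For $B\subset\mathbb N^n$ (identified with the monomial set $\mathbf x^B$) let $B^+=B\cup\bigcup_i(B+e_i)$, where $e_i$ is the exponent of $x_i$, let $\partial B=B^+\setminus B$, and let $\langle\mathbf x^B\rangle$ be the linear span of the monomials $\mathbf x^\beta$, $\beta\in B$. $B$ is connected to $1$ if $0\in B$ and every nonzero $\beta\in B$ is $\beta'+e_i$ for some $\beta'\in B$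 and some $i$. A family $F$ is a border basis of an ideal $I$ with respect to $\mathbf x^B$ if its members are $f_\alpha=\mathbf x^\alpha+b_\alpha$ with $b_\alpha\in\langle\mathbf x^B\rangle$, one for each $\alpha\in\partial B$, if $\mathbb K[\mathbf x]=\langle\mathbf x^B\rangle\oplus(F)$, and if $(F)=I$. For lists $[p_1,\dots,p_l]$, $[m_1,\dots,m_l]$ of polynomials, $\mathrm{proj}(f,[p_i],[m_i])$ is the value of $g$ obtained by setting $g:=f$ and then, for $i=1,\dots,l$ in turn, $g:=g-\langle g,m_i\rangle_\sigma\,p_i$. **Algorithm 1.** Input: a finite list $\mathbf a$ of distinct exponents in $\mathbb N^n$ that is connected to $1$, and the coefficients $\sigma_\alpha$, $\alpha\in\mathbf a$, of a series $\sigma$. Start with $\mathbf b=\mathbf c=\mathbf d=[\,]$, $\mathbf s=\mathbf t=\mathbf a$, $\mathbf n=[0]$. While $\mathbf n\ne\emptyset$: for each $\alpha\in\mathbf n$ in turn, let $p_\alpha=\mathrm{proj}(\mathbf x^\alpha,[p_\beta]_{\beta\in\mathbf b},[m_\beta]_{\beta\in\mathbf b})$ and look for the first $\gamma\in\mathbf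 t$ with $\mathbf x^\gamma p_\alpha\in\langle\mathbf x^{\mathbf a}\rangle$ and $\langle p_\alpha,\mathbf x^\gamma\rangle_\sigma\ne0$. If there is one, let $m_\alpha=\mathbf x^\gamma/\langle p_\alpha,\mathbf x^\gamma\rangle_\sigma$ and $q_\alpha=\mathrm{proj}(m_\alpha,[q_\beta]_{\beta\in\mathbf b},[p_\beta]_{\beta\in\mathbf b})$, append $\alpha$ to $\mathbf b$ and $\gamma$ to $\mathbf c$, and remove $\alpha$ from $\mathbf s$ and $\gamma$ from $\mathbf t$; otherwise append $\alpha$ to $\mathbf d$ and remove it from $\mathbf s$. After all $\alpha\in\mathbf n$ have been treated, replace $\mathbf n$ by the set, listed in any order, of all $\nu\in\partial\mathbf b\cap\mathbf s$ with $\nu\notin\mathbf d$ and $\nu+\gamma\in\mathbf a$ for all $\gamma\in\mathbf c$. The output is $\mathbf b=[\beta_1,\dots,\beta_r]$, $\mathbf c=[\gamma_1,\dots,\gamma_r]$, $\mathbf p=[p_{\beta_1},\dots,p_{\beta_r}]$, $\mathbf q=[q_{\beta_1},\dots,q_{\beta_r}]$ and $\mathbf k=[p_\alpha]_{\alpha\in\mathbf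 d}$. **Theorem.** Suppose that the algorithm stops with $\mathbf d=\partial\mathbf b$ (as sets) and that there is a set $\mathbf b'\subset\mathbb N^n$, connected to $1$, with $\mathbf c^+\subset\mathbf b'$ and $\mathbf x^{\mathbf b^+}\cdot\mathbf x^{\mathbf b'}=\mathbf x^{\mathbf a}$ (that is, $\{\beta+\beta' : \beta\in\mathbf b^+,\ \beta'\in\mathbf b'\}=\mathbf a$). Then $\sigma$ coincides on $\langle\mathbf x^{\mathbf a}\rangle$ with a series $\tilde\sigma\in\mathbb K^{\mathbb N^n}$ such that 1. $\operatorname{rank}H_{\tilde\sigma}=r=|\mathbf b|$; 2. $\mathbf p$ and $\mathbf q$ are bases of $\mathcal A_{\tilde\sigma}$, pairwise orthogonal for $\langle\cdot,\cdot\rangle_{\tilde\sigma}$: $\langle p_{\beta_i},q_{\beta_j}\rangle_{\tilde\sigma}=1$ if $i=j$ and $0$ otherwise; 3. $\mathbf k=\{p_\alpha:\alpha\in\partial\mathbf b\}$ is a border basis of the ideal $I_{\tilde\sigma}$ with respect to $\mathbf x^{\mathbf b}$; 4. for $k=1,\dots,n$, the matrix of multiplication by $x_k$ in the basis $\mathbf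 p$ of $\mathcal A_{\tilde\sigma}$ is $M_k=(\langle\sigma\mid x_k\,p_{\beta_j}q_{\beta_i}\rangle)_{1\le i,j\le r}$ (the $j$-th column holds the coordinates of $x_kp_{\beta_j}$), and in the basis $\mathbf q$ it is $M_k^{t}$. -/

import Mathlib

open MvPolynomial
open scoped Pointwise

noncomputable section

namespace AGBasis

variable {n : ℕ} {K : Type*} [Field K]

/-! ### Exponents and monomial sets -/

/-- Exponents `α ∈ ℕⁿ`; a set of monomials is identified with its set of exponents. -/
abbrev Expo (n : ℕ) : Type := Fin n →₀ ℕ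

/-- The monomial `x^α`. -/
abbrev mon (K : Type*) [Field K] (α : Expo n) : MvPolynomial (Fin n) K := monomial α 1

/-- `B⁺ = B ∪ x₁B ∪ ⋯ ∪ xₙB`. -/
def plus (B : Set (Expo n)) : Set (Expo n) :=
  B ∪ {α | ∃ i : Fin n, ∃ β ∈ B, α = β + Finsupp.single i 1}

/-- The border `∂B = B⁺ \ B`. -/
def border (B : Set (Expo n)) : Set (Expo n) := plus B \ B

/-- A set of monomials connected to `1`. -/
def ConnectedToOne (B : Set (Expo n)) : Prop :=
  0 ∈ B ∧ ∀ β ∈ B, β ≠ 0 → ∃ β' ∈ B, ∃ i : Fin n, β = β' + Finsupp.single i 1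

/-- The vector space `⟨x^B⟩` spanned by the monomials with exponents in `B`. -/
def monSpan (K : Type*) [Field K] (B : Set (Expo n)) : Submodule K (MvPolynomial (Fin n) K) :=
  Submodule.span K (mon K '' B)

/-! ### Sequences, linear forms and Hankel operators -/

/-- The linear form `p ↦ ⟨σ | p⟩ = ∑ p_α σ_α` attached to a sequence (series) `σ`. -/
def form (σ : Expo n → K) : MvPolynomial (Fin n) K →ₗ[K] K :=
  (basisMonomials (Fin n) K).constr K σ

theorem form_eq_sum (σ : Expo n → K) (p : MvPolynomial (Fin n) K) :
    form σ p = ∑ α ∈ p.support, p.coeff α * σ α := by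
  simp only [form, Module.Basis.constr_apply, smul_eq_mul]
  rfl

/-- The inner product `⟨p, q⟩_σ = ⟨σ | p q⟩`. -/
def inn (σ : Expo n → K) (p q : MvPolynomial (Fin n) K) : K := form σ (p * q)

/-- The Hankel operator `H_σ : p ↦ p ⋆ σ`, where `⟨p ⋆ σ | q⟩ = ⟨σ | p q⟩`. -/
def hankel (σ : Expo n → K) :
    MvPolynomial (Fin n) K →ₗ[K] Module.Dual K (MvPolynomial (Fin n) K) :=
  (LinearMap.mul K (MvPolynomial (Fin n) K)).compr₂ (form σ)

theorem hankel_apply (σ : Expo n → K) (p q : MvPolynomial (Fin n) K) :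
    hankel σ p q = form σ (p * q) := rfl

/-- The ideal `I_σ = ker H_σ`. -/
def hankelIdeal (σ : Expo n → K) : Ideal (MvPolynomial (Fin n) K) where
  __ := (LinearMap.ker (hankel σ)).toAddSubmonoid
  smul_mem' := by
    intro c p hp
    have hp' : hankel σ p = 0 := hp
    have key : hankel σ (c • p) = 0 := by
      apply LinearMap.ext
      intro q
      have h := LinearMap.congr_fun hp' (c * q)
      rw [hankel_apply] at h ⊢
      rw [smul_eq_mul, show c * p * q = p * (c * q) by ring]
      exact h
    exact key

theorem mem_hankelIdeal (σ : Expo n → K) (p : MvPolynomial (Fin n) K) :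
    p ∈ hankelIdeal σ ↔ hankel σ p = 0 := Iff.rfl

/-- The algebra `A_σ = K[x] / I_σ`. -/
abbrev HankelAlg (σ : Expo n → K) : Type _ := MvPolynomial (Fin n) K ⧸ hankelIdeal σ

/-- The class of a polynomial in `A_σ`. -/
def toAlg (σ : Expo n → K) (p : MvPolynomial (Fin n) K) : HankelAlg σ :=
  Ideal.Quotient.mk (hankelIdeal σ) p

/-- Multiplication by the variable `x_k` in `A_σ`. -/
def mulVar (σ : Expo n → K) (k : Fin n) : HankelAlg σ →ₗ[K] HankelAlg σ :=
  LinearMap.mulLeft K (toAlg σ (X k))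

/-! ### Border bases -/

/-- The family `F` is a complete rewriting family for the monomial set `B`:
`F i = x^(γ i) + (element of ⟨x^B⟩)`, where the `γ i` are distinct and are exactly the
elements of `∂B`. -/
def IsCompleteRewriting {ι : Type*} (B : Set (Expo n)) (F : ι → MvPolynomial (Fin n) K) : Prop :=
  ∃ γ : ι → Expo n, Function.Injective γ ∧ Set.range γ = border B ∧
    ∀ i, F i - mon K (γ i) ∈ monSpan K B

/-- The family `F` is a border basis of the ideal `I` with respect to the monomial set `B`:
it is a complete rewriting family, `K[x] = ⟨x^B⟩ ⊕ (F)`, and `(F) = I`. -/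
structure IsBorderBasis {ι : Type*} (B : Set (Expo n)) (F : ι → MvPolynomial (Fin n) K)
    (I : Ideal (MvPolynomial (Fin n) K)) : Prop where
  complete : IsCompleteRewriting B F
  isCompl : IsCompl (monSpan K B) ((Ideal.span (Set.range F)).restrictScalars K)
  span_eq : Ideal.span (Set.range F) = I

/-! ### The algorithm -/

/-- Orthogonal projection `proj(f, [p₁, …, p_l], [m₁, …, m_l])`: start with `g = f`, and for
`i = 1, …, l` replace `g` by `g - ⟨g, m_i⟩_σ p_i`. -/
def proj (σ : Expo n → K) (f : MvPolynomial (Fin n) K)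
    (p m : List (MvPolynomial (Fin n) K)) : MvPolynomial (Fin n) K :=
  (p.zip m).foldl (fun g pm => g - inn σ g pm.2 • pm.1) f

/-- The contents of the variables of the algorithm. The polynomials `p_α`, `q_α`, `m_α` are
stored as functions of `α`, with value `0` as long as they have not been computed. -/
structure State (n : ℕ) (K : Type*) [Field K] where
  b : List (Expo n)
  c : List (Expo n)
  d : List (Expo n)
  s : List (Expo n)
  t : List (Expo n)
  p : Expo n → MvPolynomial (Fin n) K
  q : Expo n → MvPolynomial (Fin n) K
  m : Expo n → MvPolynomial (Fin n) K

/-- Initialization. -/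
def State.init (K : Type*) [Field K] (a : List (Expo n)) : State n K where
  b := []
  c := []
  d := []
  s := a
  t := a
  p := 0
  q := 0
  m := 0

/-- The polynomial `p_α` computed when `α` is treated in the state `S`. -/
def newP (σ : Expo n → K) (S : State n K) (α : Expo n) : MvPolynomial (Fin n) K :=
  proj σ (mon K α) (S.b.map S.p) (S.b.map S.m)

/-- The condition on `γ` in the search: `x^γ p ∈ ⟨x^a⟩` and `⟨p, x^γ⟩_σ ≠ 0`. -/
def IsPivot (a : List (Expo n)) (σ : Expo n → K) (p : MvPolynomial (Fin n) K) (γ : Expo n) :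
    Prop :=
  mon K γ * p ∈ monSpan K {α | α ∈ a} ∧ inn σ p (mon K γ) ≠ 0

open Classical in
/-- The first `γ` in `t` with `x^γ p ∈ ⟨x^a⟩` and `⟨p, x^γ⟩_σ ≠ 0`, if there is one. -/
def findGamma (a : List (Expo n)) (σ : Expo n → K) (t : List (Expo n))
    (p : MvPolynomial (Fin n) K) : Option (Expo n) :=
  t.find? fun γ => decide (IsPivot a σ p γ)

/-- The monomial `m_α = x^γ / ⟨p_α, x^γ⟩_σ`. -/
def newM (σ : Expo n → K) (S : State n K) (α γ : Expo n) : MvPolynomial (Fin n) K :=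
  (inn σ (newP σ S α) (mon K γ))⁻¹ • mon K γ

/-- The polynomial `q_α`, the projection of `m_α`. -/
def newQ (σ : Expo n → K) (S : State n K) (α γ : Expo n) : MvPolynomial (Fin n) K :=
  proj σ (newM σ S α γ) (S.b.map S.q) (S.b.map S.p)

/-- Body of the inner loop: the treatment of one exponent `α`. -/
def treat (a : List (Expo n)) (σ : Expo n → K) (S : State n K) (α : Expo n) : State n K :=
  match findGamma a σ S.t (newP σ S α) with
  | some γ =>
    { b := S.b ++ [α]
      c := S.c ++ [γ]
      d := S.d
      s := S.s.erase α
      t := S.t.erase γ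
      p := Function.update S.p α (newP σ S α)
      q := Function.update S.q α (newQ σ S α γ)
      m := Function.update S.m α (newM σ S α γ) }
  | none =>
    { b := S.b
      c := S.c
      d := S.d ++ [α]
      s := S.s.erase α
      t := S.t
      p := Function.update S.p α (newP σ S α)
      q := S.q
      m := S.m }

/-- One pass of the `while` loop: the elements of the list `ν` are treated one after another. -/
def pass (a : List (Expo n)) (σ : Expo n → K) (S : State n K) (ν : List (Expo n)) : State n K :=
  ν.foldl (treat a σ) S

/-- `next(b, d, c, s)`: the exponents in `∂b ∩ s` that are not in `d` and whose sums with all the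
elements of `c` lie in `a`. -/
def next (a : List (Expo n)) (S : State n K) : Set (Expo n) :=
  {ν | ν ∈ border {β | β ∈ S.b} ∧ ν ∈ S.s ∧ ν ∉ S.d ∧ ∀ γ ∈ S.c, ν + γ ∈ a}

/-- `Reaches a σ S ν`: on the input `(σ_α)_{α ∈ a}`, the algorithm can arrive at the test of the
`while` loop with its variables in state `S` and the list `ν` of exponents still to be treated.
The elements of `next` may be listed in any order. -/
inductive Reaches (a : List (Expo n)) (σ : Expo n → K) : State n K → List (Expo n) → Prop
  | start : Reaches a σ (State.init K a) [0]
  | loop (S : State n K) (ν ν' : List (Expo n)) (h : Reaches a σ S ν) (hν : ν ≠ [])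
      (hnodup : ν'.Nodup) (hmem : ∀ α, α ∈ ν' ↔ α ∈ next a (pass a σ S ν)) :
      Reaches a σ (pass a σ S ν) ν'

/-- The algorithm stops in state `S`. -/
def StopsAt (a : List (Expo n)) (σ : Expo n → K) (S : State n K) : Prop := Reaches a σ S []

/-- The output `p = [p_{β₁}, …, p_{β_r}]`. -/
def State.outP (S : State n K) (i : Fin S.b.length) : MvPolynomial (Fin n) K := S.p (S.b.get i)

/-- The output `q = [q_{β₁}, …, q_{β_r}]`. -/
def State.outQ (S : State n K) (i : Fin S.b.length) : MvPolynomial (Fin n) K := S.q (S.b.get i)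

/-- The output `k = [p_α]_{α ∈ d}`. -/
def State.outK (S : State n K) (i : Fin S.d.length) : MvPolynomial (Fin n) K := S.p (S.d.get i)

/-- The matrix `M_k = (⟨σ | x_k p_{β_j} q_{β_i}⟩)_{i, j}`. -/
def State.multMatrix (σ : Expo n → K) (S : State n K) (k : Fin n) :
    Matrix (Fin S.b.length) (Fin S.b.length) K :=
  Matrix.of fun i j => form σ (X k * S.outP j * S.outQ i)

end AGBasis

end

namespace AGBasis

/-! ### Bases of `A_τ` from dual families -/

section DualFamilies

variable {n : ℕ} {K : Type*} [Field K] {ι : Type*} [Fintype ι]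

/-! The algorithm is a two-sided Gram–Schmidt process. Writing `b`, `c`, `d` for its final lists, it
yields a basis `p` of `⟨x^b⟩` and a dual family `q` in `⟨x^c⟩`, and for each border exponent `α` a
polynomial `p_α ∈ x^α + ⟨x^b⟩` orthogonal to `⟨x^b'⟩`; this is `Reaches.inv` combined with `b⁺ + b'
= a`, and it is packaged as `FlatData`.

From there the argument is a flat extension. The map `π f = ∑ ⟨f, q_i⟩ p_i` projects onto `⟨x^b⟩`,
and on `⟨x^(b⁺)⟩` it does not change pairings with `⟨x^b'⟩` (`form_π_mul`). Hence `T_k = π ∘ x_k`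
satisfies `⟨T_k v, g⟩ = ⟨v, x_k g⟩` for `g ∈ ⟨x^b'⟩`. Since `c⁺ ⊆ b'`, this applies to `q_i` and
then to `x_k q_i`, so the `T_k` commute (`T_commute`) and make `⟨x^b⟩` a `K[x]`-module. Letting `f`
act on `1` gives a normal form `φ f`, and `τ = σ ∘ φ` is the extension: it agrees with `σ` on
`⟨x^a⟩`, and `I_τ = ker φ` (`exists_extension`). The bases, the rank and the matrices then follow
from duality, and the border basis from the normal form. -/

theorem inn_comm (σ : Expo n → K) (f g : MvPolynomial (Fin n) K) : inn σ f g = inn σ g f := by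
  rw [inn, inn, mul_comm]

theorem mem_hankelIdeal_iff (τ : Expo n → K) (f : MvPolynomial (Fin n) K) :
    f ∈ hankelIdeal τ ↔ ∀ g, form τ (f * g) = 0 := by
  rw [mem_hankelIdeal, LinearMap.ext_iff]
  rfl

theorem toAlg_eq_iff (τ : Expo n → K) (f g : MvPolynomial (Fin n) K) :
    toAlg τ f = toAlg τ g ↔ f - g ∈ hankelIdeal τ :=
  Ideal.Quotient.eq

theorem toAlg_sum (τ : Expo n → K) (c : ι → K) (p : ι → MvPolynomial (Fin n) K) :
    toAlg τ (∑ i, c i • p i) = ∑ i, c i • toAlg τ (p i) := by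
  simp only [toAlg, map_sum]
  rfl

/-- The expansion gives spanning. Pairing with `q j` is well defined modulo `I_τ`, so it gives
independence and reads off coordinates. -/
theorem exists_basis_of_dual [DecidableEq ι] (τ : Expo n → K) (p q : ι → MvPolynomial (Fin n) K)
    (hpq : ∀ i j, inn τ (p i) (q j) = if i = j then 1 else 0)
    (hp : ∀ f, f - ∑ i, inn τ f (q i) • p i ∈ hankelIdeal τ) :
    ∃ P : Module.Basis ι K (HankelAlg τ), (∀ i, P i = toAlg τ (p i)) ∧
      ∀ f i, P.repr (toAlg τ f) i = inn τ f (q i) := by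
  have hli : LinearIndependent K (fun i => toAlg τ (p i)) := by
    rw [Fintype.linearIndependent_iff]
    intro c hc j
    rw [← toAlg_sum] at hc
    have h0 : toAlg τ (0 : MvPolynomial (Fin n) K) = 0 := map_zero _
    rw [← h0, toAlg_eq_iff, sub_zero, mem_hankelIdeal_iff] at hc
    have := hc (q j)
    rw [Finset.sum_mul, map_sum] at this
    simp only [smul_mul_assoc, map_smul] at this
    change ∑ i, c i • inn τ (p i) (q j) = 0 at this
    simpa [hpq] using this
  have hrep : ∀ f, toAlg τ f = ∑ i, inn τ f (q i) • toAlg τ (p i) := fun f => by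
    rw [← toAlg_sum, toAlg_eq_iff]
    exact hp f
  have hsp : ⊤ ≤ Submodule.span K (Set.range fun i => toAlg τ (p i)) := by
    rintro x -
    obtain ⟨f, rfl⟩ := Ideal.Quotient.mk_surjective x
    change toAlg τ f ∈ _
    rw [hrep f]
    exact Submodule.sum_mem _ fun i _ =>
      Submodule.smul_mem _ _ (Submodule.subset_span ⟨i, rfl⟩)
  refine ⟨Module.Basis.mk hli hsp, fun i => by simp, fun f i => ?_⟩
  have h : toAlg τ f = ∑ i, inn τ f (q i) • Module.Basis.mk hli hsp i := by
    rw [hrep f]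
    simp
  rw [h, Module.Basis.repr_sum_self]

/-- The form is symmetric: pairing the `q`-expansion of `f` with `h` gives the same number as
pairing the `p`-expansion of `h` with `f`. -/
theorem sub_sum_dual_mem (τ : Expo n → K) (p q : ι → MvPolynomial (Fin n) K)
    (hp : ∀ f, f - ∑ i, inn τ f (q i) • p i ∈ hankelIdeal τ) (f : MvPolynomial (Fin n) K) :
    f - ∑ i, inn τ f (p i) • q i ∈ hankelIdeal τ := by
  rw [mem_hankelIdeal_iff]
  intro h
  have h1 := (mem_hankelIdeal_iff τ _).1 (hp h) f
  rw [sub_mul, map_sub, Finset.sum_mul, map_sum, sub_eq_zero] at h1 ⊢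
  rw [mul_comm f h, h1]
  refine Finset.sum_congr rfl fun i _ => ?_
  simp only [smul_mul_assoc, map_smul, smul_eq_mul, inn]
  rw [mul_comm (p i) f, mul_comm h (q i), mul_comm]

theorem rank_hankel_of_dual [DecidableEq ι] (τ : Expo n → K) (p q : ι → MvPolynomial (Fin n) K)
    (hpq : ∀ i j, inn τ (p i) (q j) = if i = j then 1 else 0)
    (hp : ∀ f, f - ∑ i, inn τ f (q i) • p i ∈ hankelIdeal τ) :
    LinearMap.rank (hankel τ) = (Fintype.card ι : Cardinal) := by
  have hli : LinearIndependent K (fun i => hankel τ (p i)) := by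
    rw [Fintype.linearIndependent_iff]
    intro c hc j
    have := LinearMap.congr_fun hc (q j)
    simp only [LinearMap.sum_apply, LinearMap.smul_apply, hankel_apply] at this
    change ∑ i, c i • inn τ (p i) (q j) = 0 at this
    simpa [hpq] using this
  have hr : LinearMap.range (hankel τ) = Submodule.span K (Set.range fun i => hankel τ (p i)) := by
    apply le_antisymm
    · rintro _ ⟨f, rfl⟩
      have h := hp f
      rw [mem_hankelIdeal, map_sub, sub_eq_zero, map_sum] at h
      rw [h]
      refine Submodule.sum_mem _ fun i _ => ?_
      rw [map_smul]
      exact Submodule.smul_mem _ _ (Submodule.subset_span ⟨i, rfl⟩)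
    · rw [Submodule.span_le]
      rintro _ ⟨i, rfl⟩
      exact ⟨p i, rfl⟩
  rw [LinearMap.rank, hr, rank_span hli]
  simpa using Cardinal.mk_range_eq_of_injective hli.injective

end DualFamilies

/-! ### Commuting operators -/

open scoped IsMulCommutative in
-- Commuting operators generate a commutative subalgebra, in which polynomials can be evaluated.
theorem exists_algHom_of_commute {K V ι : Type*} [Field K] [AddCommGroup V] [Module K V]
    (T : ι → Module.End K V) (hT : ∀ i j, T i * T j = T j * T i) :
    ∃ Φ : MvPolynomial ι K →ₐ[K] Module.End K V, ∀ i, Φ (X i) = T i := by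
  have hc : ∀ x ∈ Set.range T, ∀ y ∈ Set.range T, x * y = y * x := by
    rintro _ ⟨i, rfl⟩ _ ⟨j, rfl⟩
    exact hT i j
  have := Algebra.isMulCommutative_adjoin K hc
  let Ψ : MvPolynomial ι K →ₐ[K] Algebra.adjoin K (Set.range T) :=
    aeval fun i => ⟨T i, Algebra.subset_adjoin ⟨i, rfl⟩⟩
  refine ⟨(Algebra.adjoin K (Set.range T)).val.comp Ψ, fun i => ?_⟩
  change ((Ψ (X i) : Algebra.adjoin K (Set.range T)) : Module.End K V) = T i
  simp only [Ψ, aeval_X]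

/-! ### Spans of monomials -/

section Span

variable {n : ℕ} {K : Type*} [Field K]

theorem mon_mem_monSpan {B : Set (Expo n)} {α : Expo n} (h : α ∈ B) : mon K α ∈ monSpan K B :=
  Submodule.subset_span ⟨α, h, rfl⟩

theorem monSpan_mono {B C : Set (Expo n)} (h : B ⊆ C) : monSpan K B ≤ monSpan K C :=
  Submodule.span_mono (Set.image_mono h)

theorem mon_mul_mon (α β : Expo n) : mon K α * mon K β = mon K (α + β) := by
  rw [mon, mon, monomial_mul, one_mul]

theorem mon_zero : mon K (0 : Expo n) = 1 := rfl

theorem mon_add_single (β : Expo n) (i : Fin n) :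
    mon K (β + Finsupp.single i 1) = X i * mon K β := by
  rw [← mon_mul_mon, mul_comm]
  rfl

theorem mul_mem_monSpan_add {B C : Set (Expo n)} {f g : MvPolynomial (Fin n) K}
    (hf : f ∈ monSpan K B) (hg : g ∈ monSpan K C) : f * g ∈ monSpan K (B + C) := by
  have h := Submodule.mul_mem_mul hf hg
  rw [monSpan, monSpan, Submodule.span_mul_span] at h
  refine Submodule.span_mono ?_ h
  rintro _ ⟨_, ⟨β, hβ, rfl⟩, _, ⟨γ, hγ, rfl⟩, rfl⟩
  exact ⟨β + γ, Set.add_mem_add hβ hγ, (mon_mul_mon β γ).symm⟩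

theorem X_mul_mem_monSpan_plus {B : Set (Expo n)} {f : MvPolynomial (Fin n) K} (k : Fin n)
    (hf : f ∈ monSpan K B) : X k * f ∈ monSpan K (plus B) := by
  induction hf using Submodule.span_induction with
  | mem x hx =>
    obtain ⟨β, hβ, rfl⟩ := hx
    rw [← mon_add_single]
    exact mon_mem_monSpan (Or.inr ⟨k, β, hβ, rfl⟩)
  | zero => simp
  | add x y _ _ hx hy => rw [mul_add]; exact add_mem hx hy
  | smul c x _ hx => rw [mul_smul_comm]; exact Submodule.smul_mem _ _ hx

theorem subset_plus (B : Set (Expo n)) : B ⊆ plus B := Set.subset_union_left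

/-- Induction on the degree: the predecessor supplied by connectedness has degree one less and stays
in `B`. -/
theorem ConnectedToOne.induction {B : Set (Expo n)} (hB : ConnectedToOne B)
    {P : Expo n → Prop} (zero : P 0)
    (step : ∀ β ∈ B, ∀ i, β + Finsupp.single i 1 ∈ B → P β → P (β + Finsupp.single i 1)) :
    ∀ β ∈ B, P β := by
  have key : ∀ d : ℕ, ∀ β ∈ B, Finsupp.degree β = d → P β := by
    intro d
    induction d with
    | zero =>
      intro β _ hd
      rw [Finsupp.degree_eq_zero_iff] at hd
      exact hd ▸ zero
    | succ d ih =>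
      intro β hβ hd
      have hne : β ≠ 0 := by
        rintro rfl
        simp at hd
      obtain ⟨β', hβ', i, rfl⟩ := hB.2 β hβ hne
      refine step β' hβ' i hβ (ih β' hβ' ?_)
      rw [map_add, Finsupp.degree_single] at hd
      omega
  exact fun β hβ => key _ β hβ rfl

/-- A subspace containing `1` and closed under multiplication by the variables is everything. -/
theorem eq_top_of_X_mul_mem (W : Submodule K (MvPolynomial (Fin n) K)) (h1 : 1 ∈ W)
    (hX : ∀ i, ∀ f ∈ W, X i * f ∈ W) : W = ⊤ := by
  rw [eq_top_iff]
  rintro f -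
  have h : ∀ g : MvPolynomial (Fin n) K, ∀ f ∈ W, g * f ∈ W := by
    intro g
    induction g using MvPolynomial.induction_on with
    | C c => intro f hf; rw [C_mul']; exact W.smul_mem c hf
    | add p q hp hq => intro f hf; rw [add_mul]; exact add_mem (hp f hf) (hq f hf)
    | mul_X p i hp => intro f hf; rw [mul_assoc]; exact hp _ (hX i f hf)
  simpa using h f 1 h1

/-- Modulo a family rewriting the border of `B`, every polynomial reduces to `⟨x^B⟩`. -/
theorem monSpan_sup_span_eq_top {ι : Type*} {B : Set (Expo n)} (h0 : (0 : Expo n) ∈ B)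
    (F : ι → MvPolynomial (Fin n) K) (hF : IsCompleteRewriting B F) :
    monSpan K B ⊔ (Ideal.span (Set.range F)).restrictScalars K = ⊤ := by
  obtain ⟨γ, -, hγ, hF⟩ := hF
  set J := (Ideal.span (Set.range F)).restrictScalars K
  have hplus : monSpan K (plus B) ≤ monSpan K B ⊔ J := by
    rw [monSpan, Submodule.span_le]
    rintro _ ⟨α, hα, rfl⟩
    by_cases hαB : α ∈ B
    · exact Submodule.mem_sup_left (mon_mem_monSpan hαB)
    · obtain ⟨i, rfl⟩ : α ∈ Set.range γ := hγ ▸ ⟨hα, hαB⟩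
      have hJ : F i ∈ J := Ideal.subset_span ⟨i, rfl⟩
      have := Submodule.sub_mem _ (Submodule.mem_sup_right (S := monSpan K B) hJ)
        (Submodule.mem_sup_left (hF i))
      simpa using this
  refine eq_top_of_X_mul_mem _ (Submodule.mem_sup_left (mon_mem_monSpan h0)) fun i f hf => ?_
  obtain ⟨v, hv, w, hw, rfl⟩ := Submodule.mem_sup.1 hf
  rw [mul_add]
  refine add_mem (hplus (X_mul_mem_monSpan_plus i hv)) (Submodule.mem_sup_right ?_)
  exact Ideal.mul_mem_left _ _ hw

end Span

/-! ### Flat extension -/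

section FlatExtension

variable {n : ℕ} {K : Type*} [Field K] {ι : Type*} [DecidableEq ι]

/-- A sequence with a dual pair of families for `⟨x^B⟩` and `⟨x^C⟩`, and rewriting rules for the
border of `B` which are orthogonal to `⟨x^B'⟩`, where `C⁺ ⊆ B'`. -/
structure FlatData (B B' C : Set (Expo n)) (σ : Expo n → K)
    (p q : ι → MvPolynomial (Fin n) K) : Prop where
  conn : ConnectedToOne B
  conn' : ConnectedToOne B'
  plus_subset : plus C ⊆ B'
  span_p : Submodule.span K (Set.range p) = monSpan K B
  q_mem : ∀ i, q i ∈ monSpan K C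
  dual : ∀ i j, inn σ (p i) (q j) = if i = j then 1 else 0
  rewriting : ∀ α ∈ border B, ∃ k, k - mon K α ∈ monSpan K B ∧
    ∀ g ∈ monSpan K B', inn σ k g = 0

variable {B B' C : Set (Expo n)} {σ : Expo n → K} {p q : ι → MvPolynomial (Fin n) K}

namespace FlatData

theorem p_mem (H : FlatData B B' C σ p q) (i : ι) : p i ∈ monSpan K B :=
  H.span_p ▸ Submodule.subset_span ⟨i, rfl⟩

theorem C_subset (H : FlatData B B' C σ p q) : C ⊆ B' := (subset_plus C).trans H.plus_subset

theorem q_mem' (H : FlatData B B' C σ p q) (i : ι) : q i ∈ monSpan K B' :=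
  monSpan_mono H.C_subset (H.q_mem i)

variable [Fintype ι]

/-- The projection `f ↦ ∑ ⟨f, q_i⟩ p_i` onto `⟨x^B⟩`. -/
noncomputable def π (H : FlatData B B' C σ p q) : MvPolynomial (Fin n) K →ₗ[K] monSpan K B :=
  ∑ i, ((form σ).comp (LinearMap.mulRight K (q i))).smulRight ⟨p i, H.p_mem i⟩

theorem coe_π (H : FlatData B B' C σ p q) (f : MvPolynomial (Fin n) K) :
    (H.π f : MvPolynomial (Fin n) K) = ∑ i, inn σ f (q i) • p i := by
  simp [π, inn]

theorem π_of_mem (H : FlatData B B' C σ p q) {f : MvPolynomial (Fin n) K}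
    (hf : f ∈ monSpan K B) : (H.π f : MvPolynomial (Fin n) K) = f := by
  rw [← H.span_p] at hf
  induction hf using Submodule.span_induction with
  | mem x hx =>
    obtain ⟨j, rfl⟩ := hx
    rw [coe_π]
    simp [H.dual]
  | zero => simp
  | add x y _ _ hx hy => rw [map_add, Submodule.coe_add, hx, hy]
  | smul c x _ hx => rw [map_smul, Submodule.coe_smul, hx]

/-- The projection `π` fixes `⟨x^B⟩` and depends only on the pairings with the `q_i`. -/
theorem ext_q (H : FlatData B B' C σ p q) {v w : monSpan K B}
    (h : ∀ i, inn σ v (q i) = inn σ w (q i)) : v = w := by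
  apply Subtype.ext
  rw [← H.π_of_mem v.2, ← H.π_of_mem w.2, coe_π, coe_π]
  simp [h]

theorem form_π_mul (H : FlatData B B' C σ p q) {f g : MvPolynomial (Fin n) K}
    (hf : f ∈ monSpan K (plus B)) (hg : g ∈ monSpan K B') :
    form σ ((H.π f : MvPolynomial (Fin n) K) * g) = form σ (f * g) := by
  induction hf using Submodule.span_induction with
  | mem x hx =>
    obtain ⟨α, hα, rfl⟩ := hx
    by_cases hαB : α ∈ B
    · rw [H.π_of_mem (mon_mem_monSpan hαB)]
    · obtain ⟨k, hk, hk'⟩ := H.rewriting α ⟨hα, hαB⟩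
      -- The rule `k` is orthogonal to every `q_i`, so `π` replaces `x^α` by `x^α - k`; the
      -- discarded `k` is orthogonal to `g`.
      have hπ : H.π k = 0 := Subtype.ext (by simp [coe_π, hk' _ (H.q_mem' _)])
      have h1 := H.π_of_mem hk
      rw [map_sub, hπ, zero_sub, Submodule.coe_neg] at h1
      have h2 : (H.π (mon K α) : MvPolynomial (Fin n) K) = mon K α - k := by
        rw [← neg_neg (H.π (mon K α) : MvPolynomial (Fin n) K), h1, neg_sub]
      have h3 : form σ (k * g) = 0 := hk' g hg
      rw [h2, sub_mul, map_sub, h3, sub_zero]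
  | zero => simp
  | add x y _ _ hx hy => rw [map_add, Submodule.coe_add, add_mul, map_add, hx, hy, add_mul, map_add]
  | smul c x _ hx =>
    rw [map_smul, Submodule.coe_smul, smul_mul_assoc, map_smul, hx, smul_mul_assoc, map_smul]

/-- The operator of multiplication by `x_k` followed by the projection. -/
noncomputable def T (H : FlatData B B' C σ p q) (k : Fin n) : Module.End K (monSpan K B) :=
  H.π ∘ₗ LinearMap.mulLeft K (X k) ∘ₗ (monSpan K B).subtype

theorem T_apply (H : FlatData B B' C σ p q) (k : Fin n) (v : monSpan K B) :
    H.T k v = H.π (X k * (v : MvPolynomial (Fin n) K)) := rfl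

theorem form_T_mul (H : FlatData B B' C σ p q) (k : Fin n) (v : monSpan K B)
    {g : MvPolynomial (Fin n) K} (hg : g ∈ monSpan K B') :
    form σ ((H.T k v : MvPolynomial (Fin n) K) * g) = form σ ((v : MvPolynomial (Fin n) K) * (X k * g)) := by
  rw [T_apply, H.form_π_mul (X_mul_mem_monSpan_plus k v.2) hg]
  congr 1
  ring

/-- Both composites pair with `q_i` as `v` pairs with `x_k x_l q_i`. The second use of adjointness
needs `x_k q_i ∈ ⟨x^B'⟩`, which is why `C⁺ ⊆ B'` is required. -/
theorem T_commute (H : FlatData B B' C σ p q) (k l : Fin n) : H.T k * H.T l = H.T l * H.T k := by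
  have key : ∀ (k l : Fin n) (v : monSpan K B) (i : ι),
      inn σ (H.T k (H.T l v)) (q i) =
        form σ ((v : MvPolynomial (Fin n) K) * (X l * (X k * q i))) := fun k l v i => by
    rw [inn, H.form_T_mul k _ (H.q_mem' i), H.form_T_mul l]
    exact monSpan_mono H.plus_subset (X_mul_mem_monSpan_plus k (H.q_mem i))
  refine LinearMap.ext fun v => H.ext_q fun i => ?_
  rw [Module.End.mul_apply, Module.End.mul_apply, key, key]
  congr 2
  ring

/-- The flat extension of the sequence `σ`. -/
theorem exists_extension (H : FlatData B B' C σ p q) :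
    ∃ (τ : Expo n → K) (φ : MvPolynomial (Fin n) K →ₗ[K] monSpan K B),
      (∀ f ∈ monSpan K (plus B), φ f = H.π f) ∧
      (∀ f, ∀ g ∈ monSpan K B', form τ (f * g) = form σ ((φ f : MvPolynomial (Fin n) K) * g)) ∧
      (∀ f, f ∈ hankelIdeal τ ↔ φ f = 0) := by
  obtain ⟨Φ, hΦ⟩ := exists_algHom_of_commute H.T H.T_commute
  let e : monSpan K B := ⟨1, mon_mem_monSpan H.conn.1⟩
  -- The normal form of `f` is the result of letting `f` act on `1`.
  let φ : MvPolynomial (Fin n) K →ₗ[K] monSpan K B := (LinearMap.applyₗ e) ∘ₗ Φ.toLinearMap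
  have φ_mul : ∀ f g, φ (f * g) = Φ g (φ f) := fun f g => by
    change Φ (f * g) e = Φ g (Φ f e)
    rw [mul_comm, map_mul, Module.End.mul_apply]
  -- Along a path inside `B` every product `x_i x^β` is again in `⟨x^B⟩`, where `π` is the identity.
  have φ_B : ∀ β ∈ B, (φ (mon K β) : MvPolynomial (Fin n) K) = mon K β := by
    refine H.conn.induction ?_ fun β hβ i hi ih => ?_
    · change ((Φ 1 e : monSpan K B) : MvPolynomial (Fin n) K) = 1
      rw [map_one]
      rfl
    · rw [mon_add_single, mul_comm, φ_mul, hΦ, T_apply, ih, ← mon_add_single,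
        H.π_of_mem (mon_mem_monSpan hi), mon_add_single, mul_comm]
  have φ_plus : ∀ f ∈ monSpan K (plus B), φ f = H.π f := by
    intro f hf
    refine LinearMap.eqOn_span ?_ hf
    rintro _ ⟨α, hα, rfl⟩
    rcases hα with hα | ⟨i, β, hβ, rfl⟩
    · exact Subtype.ext ((φ_B α hα).trans (H.π_of_mem (mon_mem_monSpan hα)).symm)
    · rw [mon_add_single, mul_comm, φ_mul, hΦ, T_apply, φ_B β hβ, mul_comm]
  -- Variables pass from the operator to the second factor one at a time along a path in `B'`;
  -- adjointness is needed only against the monomials of that path.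
  have hΦB' : ∀ β ∈ B', ∀ v : monSpan K B,
      form σ (Φ (mon K β) v : MvPolynomial (Fin n) K) = form σ ((v : MvPolynomial (Fin n) K) * mon K β) := by
    refine H.conn'.induction (fun v => ?_) fun β hβ i hi ih v => ?_
    · rw [mon_zero, map_one, mul_one]
      rfl
    · rw [mon_add_single, mul_comm, map_mul, Module.End.mul_apply, hΦ, ih,
        H.form_T_mul _ _ (mon_mem_monSpan hβ), mul_comm (mon K β)]
  let τ : Expo n → K := fun α => form σ (φ (mon K α) : MvPolynomial (Fin n) K)
  have hτ : ∀ f, form τ f = form σ (φ f : MvPolynomial (Fin n) K) := by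
    have : form τ = form σ ∘ₗ (monSpan K B).subtype ∘ₗ φ := by
      refine (basisMonomials (Fin n) K).ext fun α => ?_
      rw [form, Module.Basis.constr_basis, coe_basisMonomials]
      rfl
    intro f
    rw [this]
    rfl
  have hτmul : ∀ f, ∀ g ∈ monSpan K B', form τ (f * g) = form σ ((φ f : MvPolynomial (Fin n) K) * g) := by
    intro f g hg
    induction hg using Submodule.span_induction with
    | mem x hx =>
      obtain ⟨β, hβ, rfl⟩ := hx
      rw [hτ, φ_mul, hΦB' β hβ]
    | zero => simp
    | add x y _ _ hx hy => rw [mul_add, map_add, hx, hy, mul_add, map_add]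
    | smul c x _ hx => rw [mul_smul_comm, map_smul, hx, mul_smul_comm, map_smul]
  refine ⟨τ, φ, φ_plus, hτmul, fun f => ?_⟩
  rw [mem_hankelIdeal_iff]
  -- Elements of `I_τ` are tested against the `q_i`, which separate `⟨x^B⟩`. Conversely `φ (f g) = Φ
  -- g (φ f)`, so the kernel of `φ` is stable under multiplication.
  constructor
  · intro h
    refine H.ext_q fun i => ?_
    rw [inn, ← hτmul f (q i) (H.q_mem' i), h, inn, Submodule.coe_zero, zero_mul, map_zero]
  · intro h g
    rw [hτ, φ_mul, h, map_zero, Submodule.coe_zero, map_zero]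

/-- The normal form kills `I` and fixes `⟨x^B⟩`, so the two meet only in `0`. As `(k) ⊆ I` already
complements `⟨x^B⟩`, it must equal `I`. -/
theorem border_basis {κ : Type*} {k : κ → MvPolynomial (Fin n) K} (H : FlatData B B' C σ p q)
    (hk : IsCompleteRewriting B k) (hk' : ∀ i, ∀ g ∈ monSpan K B', inn σ (k i) g = 0)
    {I : Ideal (MvPolynomial (Fin n) K)} {φ : MvPolynomial (Fin n) K →ₗ[K] monSpan K B}
    (hφ : ∀ f ∈ monSpan K (plus B), φ f = H.π f) (hI : ∀ f, f ∈ I ↔ φ f = 0) :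
    IsBorderBasis B k I := by
  have hle : Ideal.span (Set.range k) ≤ I := by
    rw [Ideal.span_le]
    rintro _ ⟨i, rfl⟩
    obtain ⟨γ, -, hγ, hkγ⟩ := hk
    have hm : k i ∈ monSpan K (plus B) := by
      have hγi : γ i ∈ border B := hγ ▸ ⟨i, rfl⟩
      have := add_mem (monSpan_mono (subset_plus B) (hkγ i)) (mon_mem_monSpan (K := K) hγi.1)
      simpa using this
    change k i ∈ I
    rw [hI, hφ _ hm]
    exact Subtype.ext (by simp [coe_π, hk' i _ (H.q_mem' _)])
  have htop := monSpan_sup_span_eq_top H.conn.1 k hk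
  have hinf : ∀ f ∈ monSpan K B, f ∈ I → f = 0 := fun f hf hfI => by
    rw [hI, hφ f (monSpan_mono (subset_plus B) hf)] at hfI
    rw [← H.π_of_mem hf, hfI, Submodule.coe_zero]
  refine ⟨hk, ⟨?_, codisjoint_iff.2 htop⟩, le_antisymm hle fun f hf => ?_⟩
  · rw [Submodule.disjoint_def]
    exact fun f hf hfJ => hinf f hf (hle hfJ)
  · obtain ⟨v, hv, w, hw, rfl⟩ := Submodule.mem_sup.1 (htop ▸ Submodule.mem_top (x := f))
    have hvI : v ∈ I := by simpa using sub_mem hf (hle hw)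
    rw [hinf v hv hvI, zero_add]
    exact hw

theorem form_eq (H : FlatData B B' C σ p q) {τ : Expo n → K}
    {φ : MvPolynomial (Fin n) K →ₗ[K] monSpan K B}
    (hφ : ∀ f ∈ monSpan K (plus B), φ f = H.π f)
    (hτ : ∀ f, ∀ g ∈ monSpan K B', form τ (f * g) = form σ ((φ f : MvPolynomial (Fin n) K) * g))
    {f : MvPolynomial (Fin n) K} (hf : f ∈ monSpan K (plus B + B')) : form τ f = form σ f := by
  refine LinearMap.eqOn_span ?_ hf
  rintro _ ⟨_, ⟨α, hα, β, hβ, rfl⟩, rfl⟩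
  have hα' := mon_mem_monSpan (K := K) hα
  have hβ' := mon_mem_monSpan (K := K) hβ
  dsimp only
  rw [← mon_mul_mon, hτ _ _ hβ', hφ _ hα', H.form_π_mul hα' hβ']

/-- The pairings of `f` with the `q_i` under `τ` are those of `φ f` under `σ`, so the sum is `φ f`,
which `φ` fixes. -/
theorem sub_sum_mem (H : FlatData B B' C σ p q) {τ : Expo n → K}
    {φ : MvPolynomial (Fin n) K →ₗ[K] monSpan K B}
    (hφ : ∀ f ∈ monSpan K (plus B), φ f = H.π f)
    (hτ : ∀ f, ∀ g ∈ monSpan K B', form τ (f * g) = form σ ((φ f : MvPolynomial (Fin n) K) * g))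
    (hI : ∀ f, f ∈ hankelIdeal τ ↔ φ f = 0) (f : MvPolynomial (Fin n) K) :
    f - ∑ i, inn τ f (q i) • p i ∈ hankelIdeal τ := by
  have h : ∑ i, inn τ f (q i) • p i = (φ f : MvPolynomial (Fin n) K) := by
    rw [← H.π_of_mem (φ f).2, coe_π]
    refine Finset.sum_congr rfl fun i _ => ?_
    rw [inn, hτ f _ (H.q_mem' i), inn]
  rw [h, hI, map_sub, hφ _ (monSpan_mono (subset_plus B) (φ f).2), sub_eq_zero]
  exact Subtype.ext (H.π_of_mem (φ f).2).symm

end FlatData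

end FlatExtension

/-! ### Projections -/

section Projection

variable {n : ℕ} {K : Type*} [Field K]

theorem inn_sub_left (σ : Expo n → K) (f g h : MvPolynomial (Fin n) K) :
    inn σ (f - g) h = inn σ f h - inn σ g h := by
  rw [inn, sub_mul, map_sub, inn, inn]

theorem inn_smul_left (σ : Expo n → K) (c : K) (f h : MvPolynomial (Fin n) K) :
    inn σ (c • f) h = c * inn σ f h := by
  rw [inn, smul_mul_assoc, map_smul, inn, smul_eq_mul]

theorem inn_eq_zero_of_mem_span {σ : Expo n → K} {s : Set (MvPolynomial (Fin n) K)}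
    {f g : MvPolynomial (Fin n) K} (hs : ∀ x ∈ s, inn σ f x = 0)
    (hg : g ∈ Submodule.span K s) : inn σ f g = 0 := by
  have h : Submodule.span K s ≤ LinearMap.ker (hankel σ f) := Submodule.span_le.2 hs
  exact h hg

variable {ι : Type*} {σ : Expo n → K} {p m : ι → MvPolynomial (Fin n) K}

theorem proj_nil (f : MvPolynomial (Fin n) K) : proj σ f [] [] = f := rfl

theorem proj_map_cons (f : MvPolynomial (Fin n) K) (i : ι) (l : List ι) :
    proj σ f ((i :: l).map p) ((i :: l).map m) =
      proj σ (f - inn σ f (m i) • p i) (l.map p) (l.map m) := rfl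

theorem proj_sub_mem (f : MvPolynomial (Fin n) K) (l : List ι) :
    proj σ f (l.map p) (l.map m) - f ∈ Submodule.span K (p '' {i | i ∈ l}) := by
  induction l generalizing f with
  | nil => simp [proj_nil]
  | cons i l ih =>
    rw [proj_map_cons]
    have h1 := Submodule.span_mono (R := K)
      (Set.image_mono (f := p) fun j (hj : j ∈ l) => List.mem_cons_of_mem i hj)
      (ih (f - inn σ f (m i) • p i))
    have h2 : inn σ f (m i) • p i ∈ Submodule.span K (p '' {j | j ∈ i :: l}) :=
      Submodule.smul_mem _ _ (Submodule.subset_span ⟨i, List.mem_cons_self, rfl⟩)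
    have := sub_mem h1 h2
    rwa [sub_sub, sub_add_cancel] at this

/-- Triangular orthogonality is enough: the step at `i` cancels the pairing with `m i`, and later
steps subtract only multiples of `p j` orthogonal to `m i`. -/
theorem inn_proj_eq_zero {l : List ι} (h1 : ∀ i ∈ l, inn σ (p i) (m i) = 1)
    (h0 : l.Pairwise fun i j => inn σ (p j) (m i) = 0) (f : MvPolynomial (Fin n) K) :
    ∀ i ∈ l, inn σ (proj σ f (l.map p) (l.map m)) (m i) = 0 := by
  induction l generalizing f with
  | nil => simp
  | cons i l ih =>
    rw [List.pairwise_cons] at h0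
    rw [proj_map_cons]
    intro j hj
    rcases List.mem_cons.1 hj with rfl | hj
    · set g := f - inn σ f (m j) • p j with hg
      have hgj : inn σ g (m j) = 0 := by
        rw [hg, inn_sub_left, inn_smul_left, h1 j List.mem_cons_self, mul_one, sub_self]
      have h := inn_eq_zero_of_mem_span (σ := σ) (f := m j)
        (by rintro _ ⟨k, hk, rfl⟩; rw [inn_comm]; exact h0.1 k hk)
        (proj_sub_mem (σ := σ) (p := p) (m := m) g l)
      rw [inn_comm, inn_sub_left, hgj, sub_zero] at h
      exact h
    · exact ih (fun k hk => h1 k (List.mem_cons_of_mem i hk)) h0.2 _ j hj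

end Projection

/-! ### Invariants of the algorithm -/

section Invariants

variable {n : ℕ} {K : Type*} [Field K]

theorem plus_mono {B C : Set (Expo n)} (h : B ⊆ C) : plus B ⊆ plus C := by
  rintro α (hα | ⟨i, β, hβ, rfl⟩)
  · exact Or.inl (h hα)
  · exact Or.inr ⟨i, β, h hβ, rfl⟩

theorem span_insert_eq_of_sub_mem {M : Type*} [AddCommGroup M] [Module K M] {s t : Set M} {x y : M}
    (hst : Submodule.span K s = Submodule.span K t) (hxy : x - y ∈ Submodule.span K s) :
    Submodule.span K (insert x s) = Submodule.span K (insert y t) := by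
  rw [Submodule.span_insert, Submodule.span_insert, ← hst]
  apply le_antisymm <;> refine sup_le ?_ le_sup_right <;>
    rw [Submodule.span_singleton_le_iff_mem, Submodule.mem_sup]
  · exact ⟨y, Submodule.mem_span_singleton_self y, x - y, hxy, by abel⟩
  · exact ⟨x, Submodule.mem_span_singleton_self x, y - x, by simpa using neg_mem hxy, by abel⟩

theorem span_insert_smul_eq {M : Type*} [AddCommGroup M] [Module K M] {s t : Set M} {c : K}
    (hc : c ≠ 0) (y : M) (hst : Submodule.span K s = Submodule.span K t) :
    Submodule.span K (insert (c • y) s) = Submodule.span K (insert y t) := by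
  rw [Submodule.span_insert, Submodule.span_insert, hst,
    Submodule.span_singleton_smul_eq (IsUnit.mk0 c hc)]

theorem setOf_mem_append_singleton {ι : Type*} (l : List ι) (i : ι) :
    {j | j ∈ l ++ [i]} = insert i {j | j ∈ l} := by
  ext j
  simp [or_comm]

theorem image_update_append_singleton {ι M : Type*} [DecidableEq ι] {l : List ι} {i : ι}
    (hi : i ∉ l) (f : ι → M) (x : M) :
    Function.update f i x '' {j | j ∈ l ++ [i]} = insert x (f '' {j | j ∈ l}) := by
  rw [setOf_mem_append_singleton, Set.image_insert_eq, Function.update_self]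
  congr 1
  refine Set.image_congr fun j hj => Function.update_of_ne ?_ _ _
  rintro rfl
  exact hi hj

/-- The properties of the variables which hold throughout the algorithm. -/
structure Inv (a : List (Expo n)) (σ : Expo n → K) (S : State n K) : Prop where
  nodup_b : S.b.Nodup
  nodup_d : S.d.Nodup
  nodup_s : S.s.Nodup
  not_mem : ∀ α ∈ S.s, α ∉ S.b ∧ α ∉ S.d
  mem_t : ∀ γ ∈ a, γ ∈ S.t ∨ γ ∈ S.c
  span_p : Submodule.span K (S.p '' {β | β ∈ S.b}) = monSpan K {β | β ∈ S.b}
  span_m : Submodule.span K (S.m '' {β | β ∈ S.b}) = monSpan K {γ | γ ∈ S.c}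
  p_m : ∀ β ∈ S.b, inn σ (S.p β) (S.m β) = 1
  orth : S.b.Pairwise fun β β' => inn σ (S.p β') (S.m β) = 0
  q_mem : ∀ β ∈ S.b, S.q β ∈ monSpan K {γ | γ ∈ S.c}
  dual : ∀ β ∈ S.b, ∀ β' ∈ S.b, inn σ (S.p β) (S.q β') = if β = β' then 1 else 0
  rewriting : ∀ α ∈ S.d, S.p α - mon K α ∈ monSpan K {β | β ∈ S.b}
  ker : ∀ α ∈ S.d, ∀ γ ∈ a, mon K γ * S.p α ∈ monSpan K {α | α ∈ a} →
    inn σ (S.p α) (mon K γ) = 0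
  conn : ∀ β ∈ S.b, β ≠ 0 → ∃ β' ∈ S.b, ∃ i : Fin n, β = β' + Finsupp.single i 1

theorem Inv.init {a : List (Expo n)} (ha : a.Nodup) (σ : Expo n → K) :
    Inv a σ (State.init K a) where
  nodup_b := List.nodup_nil
  nodup_d := List.nodup_nil
  nodup_s := ha
  not_mem _ _ := ⟨List.not_mem_nil, List.not_mem_nil⟩
  mem_t _ h := Or.inl h
  span_p := by simp [State.init, monSpan]
  span_m := by simp [State.init, monSpan]
  p_m := by simp [State.init]
  orth := List.Pairwise.nil
  q_mem := by simp [State.init]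
  dual := by simp [State.init]
  rewriting := by simp [State.init]
  ker := by simp [State.init]
  conn := by simp [State.init]

variable {a : List (Expo n)} {σ : Expo n → K} {S : State n K} {α : Expo n}

theorem treat_s (a : List (Expo n)) (σ : Expo n → K) (S : State n K) (α : Expo n) :
    (treat a σ S α).s = S.s.erase α := by
  unfold treat
  split <;> rfl

theorem mem_treat_b (β : Expo n) (h : β ∈ S.b) : β ∈ (treat a σ S α).b := by
  unfold treat
  split
  · exact List.mem_append_left _ h
  · exact h

theorem mem_treat (β : Expo n) (h : β = α ∨ β ∈ S.b ∨ β ∈ S.d) :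
    β ∈ (treat a σ S α).b ∨ β ∈ (treat a σ S α).d := by
  unfold treat
  split <;> simp only [List.mem_append, List.mem_singleton] <;> tauto

namespace Inv

theorem newP_sub_mem (h : Inv a σ S) (α : Expo n) :
    newP σ S α - mon K α ∈ monSpan K {β | β ∈ S.b} :=
  h.span_p ▸ proj_sub_mem (mon K α) S.b

theorem inn_newP (h : Inv a σ S) (α : Expo n) {g : MvPolynomial (Fin n) K}
    (hg : g ∈ monSpan K {γ | γ ∈ S.c}) : inn σ (newP σ S α) g = 0 := by
  rw [← h.span_m] at hg
  refine inn_eq_zero_of_mem_span ?_ hg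
  rintro _ ⟨β, hβ, rfl⟩
  exact inn_proj_eq_zero h.p_m h.orth (mon K α) β hβ

theorem newQ_sub_mem (h : Inv a σ S) (α γ : Expo n) :
    newQ σ S α γ - newM σ S α γ ∈ monSpan K {γ | γ ∈ S.c} := by
  refine Submodule.span_le.2 ?_ (proj_sub_mem (newM σ S α γ) S.b)
  rintro _ ⟨β, hβ, rfl⟩
  exact h.q_mem β hβ

theorem inn_newQ (h : Inv a σ S) (α γ : Expo n) {β : Expo n} (hβ : β ∈ S.b) :
    inn σ (S.p β) (newQ σ S α γ) = 0 := by
  rw [inn_comm]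
  refine inn_proj_eq_zero (fun β hβ => ?_) ?_ (newM σ S α γ) β hβ
  · rw [inn_comm, h.dual β hβ β hβ, if_pos rfl]
  · refine h.nodup_b.imp_of_mem fun {β β'} hβ hβ' hne => ?_
    rw [inn_comm, h.dual β hβ β' hβ', if_neg hne]

theorem inn_newP_newM {γ : Expo n} (hγ : inn σ (newP σ S α) (mon K γ) ≠ 0) :
    inn σ (newP σ S α) (newM σ S α γ) = 1 := by
  rw [inn_comm, newM, inn_smul_left, inn_comm σ (mon K γ), inv_mul_cancel₀ hγ]

theorem inn_newP_newQ (h : Inv a σ S) {γ : Expo n} (hγ : inn σ (newP σ S α) (mon K γ) ≠ 0) :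
    inn σ (newP σ S α) (newQ σ S α γ) = 1 := by
  have h0 := h.inn_newP α (h.newQ_sub_mem α γ)
  rw [inn_comm, inn_sub_left, inn_comm, inn_comm σ (newM σ S α γ), inn_newP_newM hγ,
    sub_eq_zero] at h0
  exact h0

theorem newM_mem {γ : Expo n} : newM σ S α γ ∈ monSpan K {γ' | γ' ∈ S.c ++ [γ]} :=
  Submodule.smul_mem _ _ (mon_mem_monSpan (by simp))

theorem treat (h : Inv a σ S) (hα : α ∈ S.s) (hc : α = 0 ∨ α ∈ plus {β | β ∈ S.b}) :
    Inv a σ (treat a σ S α) := by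
  have hαb := (h.not_mem α hα).1
  have hαd := (h.not_mem α hα).2
  have hne : ∀ β ∈ S.b, β ≠ α := fun β hβ e => hαb (e ▸ hβ)
  have hned : ∀ β ∈ S.d, β ≠ α := fun β hβ e => hαd (e ▸ hβ)
  have hs : ∀ β ∈ S.s.erase α, β ≠ α ∧ β ∈ S.s := fun β => (h.nodup_s.mem_erase_iff).1
  unfold AGBasis.treat
  split
  next γ hγ =>
    have hpiv : IsPivot a σ (newP σ S α) γ := by
      have := List.find?_some hγ
      simpa using this
    have hb : monSpan K {β | β ∈ S.b} ≤ monSpan K {β | β ∈ S.b ++ [α]} :=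
      monSpan_mono fun β hβ => List.mem_append_left _ hβ
    have hcc : monSpan K {β | β ∈ S.c} ≤ monSpan K {β | β ∈ S.c ++ [γ]} :=
      monSpan_mono fun β hβ => List.mem_append_left _ hβ
    constructor <;> dsimp only
    · rw [List.nodup_append_comm]
      exact List.nodup_cons.2 ⟨hαb, h.nodup_b⟩
    · exact h.nodup_d
    · exact h.nodup_s.erase α
    · intro β hβ
      obtain ⟨h1, h2⟩ := hs β hβ
      have := h.not_mem β h2
      simp [h1, this]
    · intro γ' hγ'
      by_cases e : γ' = γ
      · simp [e]
      · rcases h.mem_t γ' hγ' with h1 | h1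
        · exact Or.inl ((List.mem_erase_of_ne e).2 h1)
        · exact Or.inr (List.mem_append_left _ h1)
    · rw [image_update_append_singleton hαb, monSpan, setOf_mem_append_singleton,
        Set.image_insert_eq]
      refine span_insert_eq_of_sub_mem h.span_p ?_
      rw [h.span_p]
      exact h.newP_sub_mem α
    · rw [image_update_append_singleton hαb, monSpan, setOf_mem_append_singleton,
        Set.image_insert_eq]
      exact span_insert_smul_eq (inv_ne_zero hpiv.2) _ h.span_m
    · intro β hβ
      rcases List.mem_append.1 hβ with hβ | hβ
      · rw [Function.update_of_ne (hne β hβ), Function.update_of_ne (hne β hβ), h.p_m β hβ]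
      · rw [List.mem_singleton.1 hβ, Function.update_self, Function.update_self,
          inn_newP_newM hpiv.2]
    · rw [List.pairwise_append]
      refine ⟨h.orth.imp_of_mem fun {β β'} hβ hβ' e => ?_, List.pairwise_singleton _ _,
        fun β hβ β' hβ' => ?_⟩
      · rwa [Function.update_of_ne (hne β hβ), Function.update_of_ne (hne β' hβ')]
      · rw [List.mem_singleton.1 hβ', Function.update_self, Function.update_of_ne (hne β hβ)]
        -- Only this half of the orthogonality holds between `p` and `m`: a new `p` is orthogonal to
        -- the old `m`, while an old `p` may pair with the new `m`. The projection defining `q`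
        -- repairs this.
        refine h.inn_newP α ?_
        rw [← h.span_m]
        exact Submodule.subset_span ⟨β, hβ, rfl⟩
    · intro β hβ
      rcases List.mem_append.1 hβ with hβ | hβ
      · rw [Function.update_of_ne (hne β hβ)]
        exact hcc (h.q_mem β hβ)
      · rw [List.mem_singleton.1 hβ, Function.update_self]
        have := add_mem (hcc (h.newQ_sub_mem α γ)) (newM_mem (σ := σ) (α := α))
        rwa [sub_add_cancel] at this
    · intro β hβ β' hβ'
      rcases List.mem_append.1 hβ with hβ | hβ <;> rcases List.mem_append.1 hβ' with hβ' | hβ'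
      · rw [Function.update_of_ne (hne β hβ), Function.update_of_ne (hne β' hβ'),
          h.dual β hβ β' hβ']
      · rw [List.mem_singleton.1 hβ', Function.update_of_ne (hne β hβ), Function.update_self,
          h.inn_newQ α γ hβ, if_neg (hne β hβ)]
      · rw [List.mem_singleton.1 hβ, Function.update_of_ne (hne β' hβ'), Function.update_self,
          h.inn_newP α (h.q_mem β' hβ'), if_neg (hne β' hβ').symm]
      · rw [List.mem_singleton.1 hβ, List.mem_singleton.1 hβ', Function.update_self,
          Function.update_self, h.inn_newP_newQ hpiv.2, if_pos rfl]
    · intro β hβ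
      rw [Function.update_of_ne (hned β hβ)]
      exact hb (h.rewriting β hβ)
    · intro β hβ
      rw [Function.update_of_ne (hned β hβ)]
      exact h.ker β hβ
    · intro β hβ h0
      rcases List.mem_append.1 hβ with hβ | hβ
      · obtain ⟨β', hβ', i, e⟩ := h.conn β hβ h0
        exact ⟨β', List.mem_append_left _ hβ', i, e⟩
      · rw [List.mem_singleton.1 hβ] at h0 ⊢
        rcases hc with hc | hc | ⟨i, β', hβ', e⟩
        · exact absurd hc h0
        · exact absurd hc hαb
        · exact ⟨β', List.mem_append_left _ hβ', i, e⟩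
  next hnone =>
    have hnp : ∀ γ ∈ S.t, ¬ IsPivot a σ (newP σ S α) γ := by
      intro γ hγ
      have := List.find?_eq_none.1 hnone γ hγ
      simpa using this
    have himage : Function.update S.p α (newP σ S α) '' {β | β ∈ S.b} = S.p '' {β | β ∈ S.b} :=
      Set.image_congr fun β hβ => Function.update_of_ne (hne β hβ) _ _
    constructor <;> dsimp only
    · exact h.nodup_b
    · rw [List.nodup_append_comm]
      exact List.nodup_cons.2 ⟨hαd, h.nodup_d⟩
    · exact h.nodup_s.erase α
    · intro β hβ
      obtain ⟨h1, h2⟩ := hs β hβ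
      have := h.not_mem β h2
      simp [h1, this]
    · exact h.mem_t
    · rw [himage, h.span_p]
    · exact h.span_m
    · intro β hβ
      rw [Function.update_of_ne (hne β hβ), h.p_m β hβ]
    · refine h.orth.imp_of_mem fun {β β'} _ hβ' e => ?_
      rwa [Function.update_of_ne (hne β' hβ')]
    · exact h.q_mem
    · intro β hβ β' hβ'
      rw [Function.update_of_ne (hne β hβ), h.dual β hβ β' hβ']
    · intro β hβ
      rcases List.mem_append.1 hβ with hβ | hβ
      · rw [Function.update_of_ne (hned β hβ)]
        exact h.rewriting β hβ
      · rw [List.mem_singleton.1 hβ, Function.update_self]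
        exact h.newP_sub_mem α
    · intro β hβ γ hγ hmem
      rcases List.mem_append.1 hβ with hβ | hβ
      · rw [Function.update_of_ne (hned β hβ)] at hmem ⊢
        exact h.ker β hβ γ hγ hmem
      · rw [List.mem_singleton.1 hβ, Function.update_self] at hmem ⊢
        -- An exponent still in `t` was rejected by the search; one already in `c` is orthogonal to
        -- `p_α` by projection. Covering all of `a` keeps the property valid when `t` and `c` change
        -- later.
        rcases h.mem_t γ hγ with hγ' | hγ'
        · by_contra hne0
          exact hnp γ hγ' ⟨hmem, hne0⟩
        · exact h.inn_newP α (mon_mem_monSpan hγ')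
    · exact h.conn

/-- Treating one exponent leaves the others in `s`, because the list has no repetition, and only
enlarges `b⁺`. The second conclusion serves to follow the exponent `0`. -/
theorem pass {ν : List (Expo n)} (hν : ν.Nodup) (h : Inv a σ S)
    (hr : ∀ α ∈ ν, α ∈ S.s ∧ (α = 0 ∨ α ∈ plus {β | β ∈ S.b})) :
    Inv a σ (pass a σ S ν) ∧ ∀ β, β ∈ ν ∨ β ∈ S.b ∨ β ∈ S.d →
      β ∈ (AGBasis.pass a σ S ν).b ∨ β ∈ (AGBasis.pass a σ S ν).d := by
  induction ν generalizing S with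
  | nil => exact ⟨h, fun β hβ => hβ.resolve_left List.not_mem_nil⟩
  | cons α ν ih =>
    obtain ⟨hα, hν⟩ := List.nodup_cons.1 hν
    have hrα := hr α List.mem_cons_self
    obtain ⟨h1, h2⟩ := ih hν (h.treat hrα.1 hrα.2) fun β hβ => by
      have hrβ := hr β (List.mem_cons_of_mem α hβ)
      refine ⟨?_, hrβ.2.imp_right fun hp => plus_mono (fun β => mem_treat_b β) hp⟩
      rw [treat_s, List.mem_erase_of_ne]
      · exact hrβ.1
      · rintro rfl
        exact hα hβ
    refine ⟨h1, fun β hβ => h2 β ?_⟩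
    rw [List.mem_cons, or_assoc, or_left_comm] at hβ
    exact hβ.imp_right fun h => mem_treat β h

end Inv

theorem Reaches.inv (ha : a.Nodup) (ha0 : (0 : Expo n) ∈ a) {ν : List (Expo n)}
    (hS : Reaches a σ S ν) :
    Inv a σ S ∧ ν.Nodup ∧ (∀ α ∈ ν, α ∈ S.s ∧ (α = 0 ∨ α ∈ plus {β | β ∈ S.b})) ∧
      (0 ∈ ν ∨ 0 ∈ S.b ∨ 0 ∈ S.d) := by
  induction hS with
  | start =>
    refine ⟨Inv.init ha σ, List.nodup_singleton 0, fun α hα => ?_, Or.inl List.mem_cons_self⟩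
    rw [List.mem_singleton] at hα
    exact ⟨hα ▸ ha0, Or.inl hα⟩
  | loop S ν ν' _ _ hnodup hmem ih =>
    obtain ⟨h, hν, hr, h0⟩ := ih
    obtain ⟨h1, h2⟩ := h.pass hν hr
    refine ⟨h1, hnodup, fun α hα => ?_, Or.inr (h2 0 h0)⟩
    obtain ⟨hb, hs, -⟩ := (hmem α).1 hα
    exact ⟨hs, Or.inr hb.1⟩

end Invariants

end AGBasis

theorem mainTheorem1 {n : ℕ} {K : Type*} [Field K]
    (a : List (AGBasis.Expo n)) (ha : a.Nodup)
    (ha1 : AGBasis.ConnectedToOne {α | α ∈ a})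
    (σ : AGBasis.Expo n → K) (S : AGBasis.State n K)
    (hS : AGBasis.StopsAt a σ S)
    (hd : {α | α ∈ S.d} = AGBasis.border {β | β ∈ S.b})
    (b' : Set (AGBasis.Expo n)) (hb' : AGBasis.ConnectedToOne b')
    (hc : AGBasis.plus {γ | γ ∈ S.c} ⊆ b')
    (hab : AGBasis.plus {β | β ∈ S.b} + b' = {α | α ∈ a}) :
    ∃ τ : AGBasis.Expo n → K,
      (∀ f ∈ AGBasis.monSpan K {α | α ∈ a}, AGBasis.form τ f = AGBasis.form σ f) ∧
      LinearMap.rank (AGBasis.hankel τ) = (S.b.length : Cardinal) ∧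
      (∀ i j, AGBasis.inn τ (S.outP i) (S.outQ j) = if i = j then 1 else 0) ∧
      AGBasis.IsBorderBasis {β | β ∈ S.b} S.outK (AGBasis.hankelIdeal τ) ∧
      ∃ P Q : Module.Basis (Fin S.b.length) K (AGBasis.HankelAlg τ),
        (∀ i, P i = AGBasis.toAlg τ (S.outP i)) ∧
        (∀ i, Q i = AGBasis.toAlg τ (S.outQ i)) ∧
        ∀ k : Fin n,
          LinearMap.toMatrix P P (AGBasis.mulVar τ k) = S.multMatrix σ k ∧
          LinearMap.toMatrix Q Q (AGBasis.mulVar τ k) = (S.multMatrix σ k).transpose := by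
  open AGBasis in
  obtain ⟨hI, -, -, h0⟩ := Reaches.inv ha ha1.1 hS
  -- The exponent `0` has been treated, and it cannot lie in `d = ∂b` because it is not of the form
  -- `β + e_i`.
  have h0b : (0 : Expo n) ∈ S.b := by
    rcases h0 with h0 | h0 | h0
    · simp at h0
    · exact h0
    · have h0' : (0 : Expo n) ∈ border {β | β ∈ S.b} := hd ▸ h0
      obtain ⟨h1 | ⟨i, β, -, e⟩, h2⟩ := h0'
      · exact h1
      · have := DFunLike.congr_fun e i
        simp at this
  have hbd : ∀ α ∈ border {β | β ∈ S.b}, α ∈ S.d := fun α hα => by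
    rw [← hd] at hα
    exact hα
  have hk : ∀ α ∈ S.d, ∀ g ∈ monSpan K b', inn σ (S.p α) g = 0 := by
    intro α hα g hg
    have hαb : α ∈ border {β | β ∈ S.b} := hd ▸ hα
    refine inn_eq_zero_of_mem_span ?_ hg
    rintro _ ⟨β, hβ, rfl⟩
    have hp : S.p α ∈ monSpan K (plus {β | β ∈ S.b}) := by
      have := add_mem (monSpan_mono (subset_plus _) (hI.rewriting α hα))
        (mon_mem_monSpan (K := K) hαb.1)
      simpa using this
    -- Since `0 ∈ b`, the set `b'` lies in `a`; since `p_α ∈ ⟨x^(b⁺)⟩`, the product `x^β p_α` lies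
    -- in `⟨x^a⟩`. So each `β ∈ b'` satisfies the search's membership condition.
    refine hI.ker α hα β ?_ ?_
    · have : 0 + β ∈ plus {β | β ∈ S.b} + b' := Set.add_mem_add (subset_plus _ h0b) hβ
      rw [hab, zero_add] at this
      exact this
    · rw [← hab, mul_comm]
      exact mul_mem_monSpan_add hp (mon_mem_monSpan hβ)
  have hget : ∀ i, S.b.get i ∈ S.b := S.b.get_mem
  have H : FlatData {β | β ∈ S.b} b' {γ | γ ∈ S.c} σ S.outP S.outQ :=
    { conn := ⟨h0b, hI.conn⟩
      conn' := hb'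
      plus_subset := hc
      span_p := by
        rw [← hI.span_p]
        congr 1
        ext f
        simp only [Set.mem_range, Set.mem_image, Set.mem_ofPred_eq, List.mem_iff_get, State.outP]
        constructor
        · rintro ⟨i, rfl⟩
          exact ⟨_, ⟨i, rfl⟩, rfl⟩
        · rintro ⟨_, ⟨i, rfl⟩, rfl⟩
          exact ⟨i, rfl⟩
      q_mem := fun i => hI.q_mem _ (hget i)
      dual := fun i j => by
        rw [State.outP, State.outQ, hI.dual _ (hget i) _ (hget j)]
        simp only [hI.nodup_b.get_inj_iff]
      rewriting := fun α hα => ⟨S.p α, hI.rewriting α (hbd α hα), hk α (hbd α hα)⟩ }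
  obtain ⟨τ, φ, hφ, hτ, hker⟩ := H.exists_extension
  have heq : ∀ f ∈ monSpan K {α | α ∈ a}, form τ f = form σ f := fun f hf =>
    H.form_eq hφ hτ (hab ▸ hf)
  have heq' : ∀ f ∈ monSpan K (plus {β | β ∈ S.b}), ∀ j,
      inn τ f (S.outQ j) = inn σ f (S.outQ j) := fun f hf j =>
    H.form_eq hφ hτ (mul_mem_monSpan_add hf (H.q_mem' j))
  have hpq : ∀ i j, inn τ (S.outP i) (S.outQ j) = if i = j then 1 else 0 := fun i j => by
    rw [heq' _ (monSpan_mono (subset_plus _) (H.p_mem i)), H.dual]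
  have hp := H.sub_sum_mem hφ hτ hker
  have hqp : ∀ i j, inn τ (S.outQ i) (S.outP j) = if i = j then 1 else 0 := fun i j => by
    rw [inn_comm, hpq]
    simp only [eq_comm]
  obtain ⟨P, hP, hPr⟩ := exists_basis_of_dual τ S.outP S.outQ hpq hp
  obtain ⟨Q, hQ, hQr⟩ := exists_basis_of_dual τ S.outQ S.outP hqp (sub_sum_dual_mem τ _ _ hp)
  have hmul : ∀ k f, mulVar τ k (toAlg τ f) = toAlg τ (X k * f) := fun k f =>
    (map_mul (Ideal.Quotient.mk (hankelIdeal τ)) (X k) f).symm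
  -- The products `x_k p_j q_i` lie in `⟨x^(b⁺ + b')⟩ = ⟨x^a⟩`, so the entries can be computed from
  -- `σ`.
  have hM : ∀ k i j, inn τ (X k * S.outP j) (S.outQ i) = S.multMatrix σ k i j := fun k i j =>
    heq' _ (X_mul_mem_monSpan_plus k (H.p_mem j)) i
  refine ⟨τ, heq, ?_, hpq, ?_, P, Q, hP, hQ, fun k => ⟨?_, ?_⟩⟩
  · rw [rank_hankel_of_dual τ S.outP S.outQ hpq hp, Fintype.card_fin]
  · refine H.border_basis ⟨S.d.get, hI.nodup_d.injective_get, ?_, fun i => ?_⟩ (fun i => ?_)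
      hφ hker
    · rw [← hd]
      exact Set.range_list_get S.d
    · exact hI.rewriting _ (S.d.get_mem i)
    · exact hk _ (S.d.get_mem i)
  · ext i j
    rw [LinearMap.toMatrix_apply, hP, hmul, hPr, hM]
  -- Multiplication by `x_k` is self-adjoint for `⟨·,·⟩_τ`, so passing to the dual basis transposes
  -- the matrix.
  · ext i j
    rw [LinearMap.toMatrix_apply, hQ, hmul, hQr, Matrix.transpose_apply, ← hM, inn, inn]
    congr 1
    ring
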